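/- Let $n \in \mathbb{N}$ and $p \in \mathbb{R}$ with $p > 2$, and let $\mathcal{C}_p = \mathbb{R}/p\mathbb{Z}$ be the circle of perimeter $p$ with its arc-length metric $\delta$. For $a, b \in \mathcal{C}_p$ let $d(a,b) \in (-p/2, p/2]$ be the representative of $b - a$ in that interval, so $|d(a,b)| = \delta(a,b)$. Given $x_0 = (x_0(1),\dots,x_0(n)) \in (\mathcal{C}_p)^n$, define $x_t \in (\mathcal{C}_p)^n$ for $t \ge 1$ by the Hegselmann–Krause update rule with confidence radius $1$: each agent moves to the average location of the agents within distance $1$ of it, i.e. with $\mathcal{N}_t(i) = \{ j : \delta(x_t(i), x_t(j)) \le 1 \}$, $$x_{t+1}(i) = x_t(i) + \frac{1}{|\mathcal{N}_t(i)|} \sum_{j \in \mathcal{N}_t(i)} d(x_t(i), x_t(j)) \pmod p .$$ Then for every $n$, every $p > 2$ and every $x_0$ the sequence $(x_t)_{t \ge 0}$ converges in the product topology: there is $x_\infty \in (\mathcal{C}_p)^n$ with $x_t \to x_\infty$ as $t \to \infty$. -/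

import Mathlib

open Filter Topology

noncomputable section

/-- The signed displacement from `a` to `b` along the circle `ℝ / pℤ` of perimeter `p`: the
representative of `b - a` in `(-p/2, p/2]`. -/
def circleDisplacement {p : ℝ} [Fact (0 < p)] (a b : AddCircle p) : ℝ :=
  (AddCircle.equivIoc p (-(p / 2)) (b - a) : ℝ)

/-- The agents `j` at circle distance at most `1` from agent `i` (including `i`). -/
def hkNeighbours {n : ℕ} {p : ℝ} (x : Fin n → AddCircle p) (i : Fin n) : Finset (Fin n) :=
  {j | dist (x i) (x j) ≤ 1}

/-- The Hegselmann-Krause update on the circle with confidence radius `1`: every agent moves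
simultaneously to the average location of the agents within distance `1`, the average being taken
along the arc of radius `1` around the agent (an arc which is isometric to `[-1, 1]` via the signed
displacement when `p > 2`). -/
def hkUpdate {n : ℕ} {p : ℝ} [Fact (0 < p)] (x : Fin n → AddCircle p) : Fin n → AddCircle p :=
  fun i => x i + (((∑ j ∈ hkNeighbours x i, circleDisplacement (x i) (x j)) /
    ((hkNeighbours x i).card : ℝ) : ℝ) : AddCircle p)

/-- The configuration at time `t` when starting from `x₀`. -/
def hkTrajectory {n : ℕ} {p : ℝ} [Fact (0 < p)] (x₀ : Fin n → AddCircle p) :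
    ℕ → Fin n → AddCircle p
  | 0 => x₀
  | t + 1 => hkUpdate (hkTrajectory x₀ t)

theorem coe_circleDisplacement {p : ℝ} [Fact (0 < p)] (a b : AddCircle p) :
    (circleDisplacement a b : AddCircle p) = b - a :=
  AddCircle.coe_equivIoc

/-- The signed displacement has the circle distance as its absolute value. -/
theorem abs_circleDisplacement {p : ℝ} [hp : Fact (0 < p)] (a b : AddCircle p) :
    |circleDisplacement a b| = dist a b := by
  have hm : circleDisplacement a b ∈ Set.Ioc (-(p / 2)) (-(p / 2) + p) :=
    (AddCircle.equivIoc p (-(p / 2)) (b - a)).2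
  have h2 : |circleDisplacement a b| ≤ |p| / 2 := by
    rw [abs_of_pos hp.out, abs_le]
    exact ⟨hm.1.le, by linarith [hm.2]⟩
  rw [dist_comm, dist_eq_norm, ← coe_circleDisplacement]
  exact ((AddCircle.norm_coe_eq_abs_iff p hp.out.ne').mpr h2).symm

/-- A real number of absolute value less than `p / 2` that leads from `a` to `b` is the signed
displacement. -/
theorem circleDisplacement_eq {p : ℝ} [hp : Fact (0 < p)] {a b : AddCircle p} {s : ℝ}
    (hs : |s| < p / 2) (h : (s : AddCircle p) = b - a) : circleDisplacement a b = s := by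
  rw [abs_lt] at hs
  unfold circleDisplacement
  rw [← h, AddCircle.equivIoc_coe_of_mem]
  exact ⟨hs.1, by linarith [hs.2]⟩

/-- If, near agent `i`, the configuration is read off in a real coordinate, then the update of
agent `i` is the usual average of the neighbours' coordinates. -/
theorem hkUpdate_eq_average {n : ℕ} {p : ℝ} [Fact (0 < p)] (hp : 2 < p)
    (x : Fin n → AddCircle p) (i : Fin n) (c : Fin n → ℝ)
    (hc : ∀ j ∈ hkNeighbours x i, (c j : AddCircle p) = x j ∧ |c j - c i| ≤ 1) :
    hkUpdate x i =
      (((∑ j ∈ hkNeighbours x i, c j) / ((hkNeighbours x i).card : ℝ) : ℝ) : AddCircle p) := by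
  have hi : i ∈ hkNeighbours x i := by simp [hkNeighbours]
  have hcard : ((hkNeighbours x i).card : ℝ) ≠ 0 := by
    exact_mod_cast (Finset.card_pos.mpr ⟨i, hi⟩).ne'
  have hd : ∀ j ∈ hkNeighbours x i, circleDisplacement (x i) (x j) = c j - c i := fun j hj =>
    circleDisplacement_eq (by linarith [(hc j hj).2])
      (by rw [AddCircle.coe_sub, (hc j hj).1, (hc i hi).1])
  unfold hkUpdate
  rw [Finset.sum_congr rfl hd, ← (hc i hi).1, ← AddCircle.coe_add]
  congr 1
  rw [Finset.sum_sub_distrib, Finset.sum_const, nsmul_eq_mul]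
  field_simp
  ring

end

/-! The truncated energy `hkEnergy` drops in each update by at least four times the sum of the
squared steps (`hkEnergy_hkUpdate_le`), so the steps tend to 0. They need not be summable, so
convergence takes a second argument. By compactness there is a cluster point `z`. The mean
displacement in `z` from an agent to a set of agents takes finitely many values. Near `z`, a small
step makes this mean small for the current neighbours, hence exactly 0. Deviations from `z` are then
merely averaged, so the sup distance to `z` cannot grow (`exists_pos_dist_hkUpdate_le`), and a
trajectory that comes close to `z` stays close. -/

open Finset in
/-- For a symmetric weight `w` and an antisymmetric flow `D` whose row sums are the weighted
velocities `m`, the first-order variation is compensated by the second-order one. -/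
theorem sum_variation_eq {ι : Type*} [Fintype ι] (w D : ι → ι → ℝ) (m : ι → ℝ)
    (hw : ∀ i j, w j i = w i j) (hD : ∀ i j, D j i = -D i j)
    (hm : ∀ i, ∑ j, D i j = ∑ j, w i j * m i) :
    ∑ i, ∑ j, (2 * D i j * (m j - m i) + w i j * (m j - m i) ^ 2) =
      -∑ i, ∑ j, w i j * (m i + m j) ^ 2 := by
  have hDs : ∑ i, ∑ j, D i j * m j = -∑ i, ∑ j, D i j * m i := by
    rw [sum_comm, ← sum_neg_distrib]
    refine sum_congr rfl fun i _ => ?_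
    rw [← sum_neg_distrib]
    exact sum_congr rfl fun j _ => by rw [hD]; ring
  have hws : ∑ i, ∑ j, w i j * m j ^ 2 = ∑ i, ∑ j, w i j * m i ^ 2 := by
    rw [sum_comm]
    exact sum_congr rfl fun i _ => sum_congr rfl fun j _ => by rw [hw]
  have hDw : ∑ i, ∑ j, D i j * m i = ∑ i, ∑ j, w i j * m i ^ 2 := by
    refine sum_congr rfl fun i _ => ?_
    rw [← sum_mul, hm, sum_mul]
    exact sum_congr rfl fun j _ => by ring
  -- The cross terms in `m i * m j` cancel between the two squares.
  have key : ∑ i, ∑ j, (2 * D i j * (m j - m i) + w i j * (m j - m i) ^ 2) +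
      ∑ i, ∑ j, w i j * (m i + m j) ^ 2 =
      2 * ∑ i, ∑ j, D i j * m j - 2 * ∑ i, ∑ j, D i j * m i +
        2 * ∑ i, ∑ j, w i j * m i ^ 2 + 2 * ∑ i, ∑ j, w i j * m j ^ 2 := by
    simp only [mul_sum, ← sum_add_distrib, ← sum_sub_distrib]
    exact sum_congr rfl fun i _ => sum_congr rfl fun j _ => by ring
  linarith

section Circle

variable {n : ℕ} {p : ℝ}

theorem circleDisplacement_swap [Fact (0 < p)] (hp : 2 < p) {a b : AddCircle p} (h : dist a b ≤ 1) :
    circleDisplacement b a = -circleDisplacement a b := by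
  refine circleDisplacement_eq ?_ ?_
  · rw [abs_neg, abs_circleDisplacement]
    linarith
  · rw [AddCircle.coe_neg, coe_circleDisplacement, neg_sub]

theorem AddCircle.norm_coe_le_abs (s : ℝ) : ‖(s : AddCircle p)‖ ≤ |s| :=
  QuotientAddGroup.norm_mk_le_norm

theorem mem_hkNeighbours {x : Fin n → AddCircle p} {i j : Fin n} :
    j ∈ hkNeighbours x i ↔ dist (x i) (x j) ≤ 1 := by
  simp [hkNeighbours]

theorem self_mem_hkNeighbours (x : Fin n → AddCircle p) (i : Fin n) : i ∈ hkNeighbours x i := by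
  simp [mem_hkNeighbours]

theorem card_hkNeighbours_pos (x : Fin n → AddCircle p) (i : Fin n) :
    (0 : ℝ) < (hkNeighbours x i).card := by
  exact_mod_cast Finset.card_pos.mpr ⟨i, self_mem_hkNeighbours x i⟩

/-- The signed distance by which agent `i` moves in one update. -/
noncomputable def hkStep [Fact (0 < p)] (x : Fin n → AddCircle p) (i : Fin n) : ℝ :=
  (∑ j ∈ hkNeighbours x i, circleDisplacement (x i) (x j)) / ((hkNeighbours x i).card : ℝ)

theorem hkUpdate_apply [Fact (0 < p)] (x : Fin n → AddCircle p) (i : Fin n) :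
    hkUpdate x i = x i + ((hkStep x i : ℝ) : AddCircle p) := rfl

/-- The energy of a configuration. -/
noncomputable def hkEnergy (x : Fin n → AddCircle p) : ℝ :=
  ∑ i, ∑ j, min 1 (dist (x i) (x j) ^ 2)

theorem hkEnergy_nonneg (x : Fin n → AddCircle p) : 0 ≤ hkEnergy x :=
  Finset.sum_nonneg fun _ _ => Finset.sum_nonneg fun _ _ => by positivity

/-- The right side is the size of one real lift of the new displacement; it may exceed `p / 2`,
hence only an inequality. -/
theorem dist_hkUpdate_le [Fact (0 < p)] (x : Fin n → AddCircle p) (i j : Fin n) :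
    dist (hkUpdate x i) (hkUpdate x j) ≤
      |circleDisplacement (x i) (x j) + (hkStep x j - hkStep x i)| := by
  rw [dist_comm, dist_eq_norm, hkUpdate_apply, hkUpdate_apply]
  refine le_trans (le_of_eq ?_) (AddCircle.norm_coe_le_abs (p := p) _)
  rw [AddCircle.coe_add, AddCircle.coe_sub, coe_circleDisplacement (x i)]
  congr 1
  abel

/-- Thanks to the truncation at 1, the old neighbour relation can be kept: old neighbours contribute
at most their new squared distance, all other pairs at most 1, which they had before. The resulting
quadratic variation is given by `sum_variation_eq`, and its diagonal terms yield the factor 4. -/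
theorem hkEnergy_hkUpdate_le [Fact (0 < p)] (hp : 2 < p) (x : Fin n → AddCircle p) :
    hkEnergy (hkUpdate x) + 4 * ∑ i, hkStep x i ^ 2 ≤ hkEnergy x := by
  classical
  set m := hkStep x with hm
  set w : Fin n → Fin n → ℝ := fun i j => if j ∈ hkNeighbours x i then 1 else 0 with hw
  set D : Fin n → Fin n → ℝ := fun i j =>
    if j ∈ hkNeighbours x i then circleDisplacement (x i) (x j) else 0 with hD
  have hsymm : ∀ i j, (i ∈ hkNeighbours x j) = (j ∈ hkNeighbours x i) := fun i j => by
    rw [mem_hkNeighbours, mem_hkNeighbours, dist_comm]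
  have hpair : ∀ i j, min 1 (dist (hkUpdate x i) (hkUpdate x j) ^ 2) ≤
      min 1 (dist (x i) (x j) ^ 2) +
        (2 * D i j * (m j - m i) + w i j * (m j - m i) ^ 2) := by
    intro i j
    by_cases hj : j ∈ hkNeighbours x i
    · have h1 := mem_hkNeighbours.mp hj
      have h2 := pow_le_pow_left₀ dist_nonneg (dist_hkUpdate_le x i j) 2
      have h3 := sq_abs (circleDisplacement (x i) (x j))
      rw [abs_circleDisplacement] at h3
      rw [sq_abs, ← hm] at h2
      rw [min_eq_right (pow_le_one₀ dist_nonneg h1)]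
      refine (min_le_right _ _).trans ?_
      simp only [hD, hw, hj, if_true]
      nlinarith
    · have h1 : 1 ≤ dist (x i) (x j) := (not_le.mp (mt mem_hkNeighbours.mpr hj)).le
      rw [min_eq_left (one_le_pow₀ h1)]
      refine (min_le_left _ _).trans ?_
      simp [hD, hw, hj]
  have hsum : ∑ i, ∑ j, (2 * D i j * (m j - m i) + w i j * (m j - m i) ^ 2) =
      -∑ i, ∑ j, w i j * (m i + m j) ^ 2 := by
    refine sum_variation_eq w D m (fun i j => ?_) (fun i j => ?_) fun i => ?_
    · simp only [hw, hsymm i j]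
    · simp only [hD, hsymm i j]
      split_ifs with h
      · exact circleDisplacement_swap hp (mem_hkNeighbours.mp h)
      · simp
    · have := (card_hkNeighbours_pos x i).ne'
      simp only [hD, hw, ← Finset.sum_mul, Finset.sum_ite_mem, Finset.univ_inter,
        Finset.sum_const, nsmul_eq_mul, mul_one, hm, hkStep]
      field_simp
  have hdiag : 4 * ∑ i, m i ^ 2 ≤ ∑ i, ∑ j, w i j * (m i + m j) ^ 2 := by
    rw [Finset.mul_sum]
    refine Finset.sum_le_sum fun i _ => ?_
    refine le_trans (le_of_eq ?_) (Finset.single_le_sum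
      (f := fun j => w i j * (m i + m j) ^ 2) (fun j _ => ?_) (Finset.mem_univ i))
    · simp only [hw, self_mem_hkNeighbours, if_true]
      ring
    · simp only [hw]
      split_ifs <;> positivity
  have htotal : hkEnergy (hkUpdate x) ≤ hkEnergy x +
      ∑ i, ∑ j, (2 * D i j * (m j - m i) + w i j * (m j - m i) ^ 2) := by
    simp only [hkEnergy, ← Finset.sum_add_distrib]
    exact Finset.sum_le_sum fun i _ => Finset.sum_le_sum fun j _ => hpair i j
  linarith

theorem tendsto_hkStep_zero [Fact (0 < p)] (hp : 2 < p) (x₀ : Fin n → AddCircle p) (i : Fin n) :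
    Tendsto (fun t => hkStep (hkTrajectory x₀ t) i) atTop (𝓝 0) := by
  set e : ℕ → ℝ := fun t => hkEnergy (hkTrajectory x₀ t) with he
  have hstep : ∀ t, e (t + 1) + 4 * ∑ i, hkStep (hkTrajectory x₀ t) i ^ 2 ≤ e t := fun t =>
    hkEnergy_hkUpdate_le hp _
  have hanti : Antitone e := antitone_nat_of_succ_le fun t => by
    have : 0 ≤ ∑ i, hkStep (hkTrajectory x₀ t) i ^ 2 :=
      Finset.sum_nonneg fun _ _ => sq_nonneg _
    linarith [hstep t]
  have hlim := tendsto_atTop_ciInf hanti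
    ⟨0, by rintro _ ⟨t, rfl⟩; exact hkEnergy_nonneg _⟩
  have hdiff : Tendsto (fun t => e t - e (t + 1)) atTop (𝓝 0) := by
    simpa using hlim.sub ((tendsto_add_atTop_iff_nat 1).mpr hlim)
  have hsq : Tendsto (fun t => hkStep (hkTrajectory x₀ t) i ^ 2) atTop (𝓝 0) := by
    refine squeeze_zero (fun t => sq_nonneg _) (fun t => ?_) hdiff
    have h1 := Finset.single_le_sum (f := fun i => hkStep (hkTrajectory x₀ t) i ^ 2)
      (fun _ _ => sq_nonneg _) (Finset.mem_univ i)
    have h2 := sq_nonneg (hkStep (hkTrajectory x₀ t) i)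
    have h3 := hstep t
    linarith
  rw [tendsto_zero_iff_abs_tendsto_zero]
  simpa [Function.comp_def, Real.sqrt_sq_eq_abs] using hsq.sqrt

/-- Among finitely many real numbers, the nonzero ones are bounded away from zero. -/
theorem exists_pos_forall_abs_lt_imp_eq_zero {ι : Type*} [Finite ι] (f : ι → ℝ) :
    ∃ ε > 0, ∀ k, |f k| < ε → f k = 0 := by
  have h : ∀ᶠ ε in 𝓝[>] (0 : ℝ), ∀ k, |f k| < ε → f k = 0 := by
    refine eventually_all.mpr fun k => ?_
    by_cases hk : f k = 0
    · exact Eventually.of_forall fun _ _ => hk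
    · filter_upwards [nhdsWithin_le_nhds (Iio_mem_nhds (abs_pos.mpr hk))] with ε hε h
      exact absurd h hε.le.not_gt
  obtain ⟨ε, hε, hpos⟩ := (h.and self_mem_nhdsWithin).exists
  exact ⟨ε, hpos, hε⟩

/-- Close to a configuration `z`, an update with small steps does not increase the distance to
`z`: for such an update the neighbours of every agent are balanced in `z`, so that the deviations
from `z` are averaged. -/
theorem exists_pos_dist_hkUpdate_le [Fact (0 < p)] (hp : 2 < p) (z : Fin n → AddCircle p) :
    ∃ ε > 0, ∀ x, dist x z < ε → (∀ i, |hkStep x i| < ε) → dist (hkUpdate x) z ≤ dist x z := by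
  obtain ⟨ε, hε, hzero⟩ := exists_pos_forall_abs_lt_imp_eq_zero
    fun k : Fin n × Finset (Fin n) =>
      (∑ j ∈ k.2, circleDisplacement (z k.1) (z j)) / (k.2.card : ℝ)
  -- The mean displacement in `z` is a step plus two deviation terms, each below `ε / 3`. The other
  -- bound keeps lifts unique: neighbours in `x` have displacement in `z` at most `1 + 2 * ((p / 2 -
  -- 1) / 4) < p / 2`.
  refine ⟨min (ε / 3) ((p / 2 - 1) / 4), lt_min (by linarith) (by linarith), ?_⟩
  intro x hx hstep
  have hx1 := hx.trans_le (min_le_left _ _)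
  have hx2 := hx.trans_le (min_le_right _ _)
  set u : Fin n → ℝ := fun i => circleDisplacement (z i) (x i) with hu
  have hux : ∀ i, |u i| ≤ dist x z := fun i => by
    rw [hu, abs_circleDisplacement, dist_comm]
    exact dist_le_pi_dist x z i
  rw [dist_pi_le_iff dist_nonneg]
  intro i
  set N := hkNeighbours x i with hN
  have hcard : (0 : ℝ) < N.card := card_hkNeighbours_pos x i
  have hd : ∀ j ∈ N, circleDisplacement (x i) (x j) =
      circleDisplacement (z i) (z j) + (u j - u i) := by
    intro j hj
    have h1 : |circleDisplacement (x i) (x j)| ≤ 1 := by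
      rw [abs_circleDisplacement]
      exact mem_hkNeighbours.mp hj
    have h2 := abs_le.mp (hux i)
    have h3 := abs_le.mp (hux j)
    have h4 : circleDisplacement (z i) (z j) =
        circleDisplacement (x i) (x j) - (u j - u i) := by
      refine circleDisplacement_eq ?_ ?_
      · rw [abs_le] at h1
        rw [abs_lt]
        constructor <;> linarith [h1.1, h1.2, h2.1, h2.2, h3.1, h3.2]
      · simp only [hu, AddCircle.coe_sub, coe_circleDisplacement]
        abel
    linarith
  have hs : hkStep x i =
      (∑ j ∈ N, circleDisplacement (z i) (z j)) / (N.card : ℝ) +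
        ((∑ j ∈ N, u j) / (N.card : ℝ) - u i) := by
    rw [hkStep, ← hN, Finset.sum_congr rfl hd, Finset.sum_add_distrib, Finset.sum_sub_distrib,
      Finset.sum_const, nsmul_eq_mul]
    field_simp
  have havg : |(∑ j ∈ N, u j) / (N.card : ℝ)| ≤ dist x z := by
    rw [abs_div, abs_of_pos hcard, div_le_iff₀ hcard]
    refine (Finset.abs_sum_le_sum_abs _ _).trans
      ((Finset.sum_le_sum fun j _ => hux j).trans (le_of_eq ?_))
    rw [Finset.sum_const, nsmul_eq_mul, mul_comm]
  have hbal : (∑ j ∈ N, circleDisplacement (z i) (z j)) / (N.card : ℝ) = 0 := by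
    refine hzero (i, N) ?_
    have h1 := abs_lt.mp ((hstep i).trans_le (min_le_left _ _))
    have h2 := abs_le.mp (hux i)
    have h3 := abs_le.mp havg
    simp only
    rw [abs_lt]
    constructor <;> linarith [h1.1, h1.2, h2.1, h2.2, h3.1, h3.2]
  have hupd : hkUpdate x i - z i = (((∑ j ∈ N, u j) / (N.card : ℝ) : ℝ) : AddCircle p) := by
    rw [hkUpdate_apply, hs, hbal, zero_add, AddCircle.coe_sub]
    simp only [hu, coe_circleDisplacement]
    abel
  rw [dist_eq_norm, hupd]
  exact (AddCircle.norm_coe_le_abs _).trans havg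

end Circle

/-- A sequence whose distance to one of its cluster points is eventually nonincreasing near that
point converges to it. -/
theorem tendsto_of_mapClusterPt_of_dist_succ_le {X : Type*} [PseudoMetricSpace X] {x : ℕ → X}
    {z : X} (hz : MapClusterPt z atTop x) {ε : ℝ} (hε : 0 < ε)
    (h : ∀ᶠ t in atTop, dist (x t) z < ε → dist (x (t + 1)) z ≤ dist (x t) z) :
    Tendsto x atTop (𝓝 z) := by
  obtain ⟨T, hT⟩ := eventually_atTop.mp h
  rw [Metric.tendsto_atTop]
  intro δ hδ
  -- Staying within `ε` keeps `h` applicable throughout the induction.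
  obtain ⟨s, hs, hsz⟩ := frequently_atTop.mp
    (mapClusterPt_iff_frequently.mp hz _ (Metric.ball_mem_nhds z (lt_min hδ hε))) T
  refine ⟨s, fun t ht => ?_⟩
  have hball : dist (x t) z < min δ ε := by
    induction t, ht using Nat.le_induction with
    | base => exact hsz
    | succ t ht ih => exact (hT t (hs.trans ht) (ih.trans_le (min_le_right _ _))).trans_lt ih
  exact hball.trans_le (min_le_left _ _)

/-- Convergence of the Hegselmann-Krause dynamics (with confidence radius `1`) on a circle of
perimeter `p > 2`, in the product topology. -/
theorem theorem1p2 (n : ℕ) (p : ℝ) [Fact (0 < p)] (hp : 2 < p) (x₀ : Fin n → AddCircle p) :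
    ∃ x_lim : Fin n → AddCircle p, Tendsto (hkTrajectory x₀) atTop (𝓝 x_lim) := by
  obtain ⟨z, -, hz⟩ := isCompact_univ.exists_mapClusterPt (u := hkTrajectory x₀) (f := atTop)
    (by simp)
  obtain ⟨ε, hε, hdist⟩ := exists_pos_dist_hkUpdate_le hp z
  refine ⟨z, tendsto_of_mapClusterPt_of_dist_succ_le hz hε ?_⟩
  have hstep : ∀ᶠ t in atTop, ∀ i, |hkStep (hkTrajectory x₀ t) i| < ε :=
    eventually_all.mpr fun i =>
      ((tendsto_hkStep_zero hp x₀ i).abs).eventually_lt_const (by simpa using hε)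
  filter_upwards [hstep] with t ht hx
  exact hdist _ hx ht
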